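/- Let $\mathbb H=\{z\in\mathbb C:\operatorname{Re} z>0\}$, and let $H^2(\mathbb H)$ be the space of analytic functions $V$ on $\mathbb H$ with $\sup_{x>0}\int_{\mathbb R}|V(x+iy)|^2\,dy<\infty$. An analytic function $V$ on $\mathbb H$ is called outer if the boundary values $V(iy):=\lim_{x\downarrow 0}V(x+iy)$ exist and are nonzero for almost every $y\in\mathbb R$, $\int_{\mathbb R}\bigl|\log|V(iy)|\bigr|\,\frac{dy}{1+y^2}<\infty$, and $|V(z)|=|O_V(z)|$ for all $z\in\mathbb H$, where $$O_V(z):=\exp\biggl\{\int_{\mathbb R}\log|V(it)|\Bigl[\frac1{z-it}-\frac{it}{1+t^2}\Bigr]\frac{dt}{\pi}\biggr\}.$$ Suppose that $V\in H^2(\mathbb H)$ is not identically zero and that, for some $n\in\mathbb N=\{0,1,2,\dots\}$, the function $W(z):=(1+z)^{-n}/V(z)$ belongs to $H^2(\mathbb H)$. Then $V$ is an outer function. -/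

import Mathlib

open MeasureTheory Filter Topology

noncomputable section

/-- The open right half-plane `{z : Re z > 0}`. -/
def rightHalfPlane : Set ℂ := {z : ℂ | 0 < z.re}

/-- Membership in the Hardy space `H²` of the right half-plane. Only the values of `V` on the
half-plane matter. -/
structure MemHardyTwo (V : ℂ → ℂ) : Prop where
  analytic : AnalyticOnNhd ℂ V rightHalfPlane
  sup_lt_top :
    (⨆ x ∈ Set.Ioi (0 : ℝ), ∫⁻ y : ℝ, ‖V ((x : ℂ) + (y : ℂ) * Complex.I)‖ₑ ^ 2) < ⊤

/-- The boundary value `V(iy) = lim_{x ↓ 0} V(x + iy)`; meaningful where the limit exists. -/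
def boundaryValue (V : ℂ → ℂ) (y : ℝ) : ℂ :=
  limUnder (𝓝[>] (0 : ℝ)) (fun x : ℝ => V ((x : ℂ) + (y : ℂ) * Complex.I))

/-- The function
`O_V(z) = exp (∫ log |V(it)| [1 / (z - it) - it / (1 + t²)] dt / π)`. -/
def outerPart (V : ℂ → ℂ) (z : ℂ) : ℂ :=
  Complex.exp (∫ t : ℝ, (Real.log ‖boundaryValue V t‖ : ℂ) *
    (1 / (z - (t : ℂ) * Complex.I) - (t : ℂ) * Complex.I / (1 + (t : ℂ) ^ 2)) / (Real.pi : ℂ))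

/-- `V` is outer: it is analytic on the right half-plane, `O_V` is well defined (the boundary
values exist and are nonzero almost everywhere and `log |V(iy)|` is integrable against
`dy / (1 + y²)`), and `|V| = |O_V|` throughout the half-plane. -/
structure IsOuterFunction (V : ℂ → ℂ) : Prop where
  analytic : AnalyticOnNhd ℂ V rightHalfPlane
  tendsto_boundaryValue : ∀ᵐ y : ℝ,
    Tendsto (fun x : ℝ => V ((x : ℂ) + (y : ℂ) * Complex.I)) (𝓝[>] (0 : ℝ))
      (𝓝 (boundaryValue V y))
  boundaryValue_ne_zero : ∀ᵐ y : ℝ, boundaryValue V y ≠ 0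
  integrable_log : Integrable (fun y : ℝ => Real.log ‖boundaryValue V y‖ / (1 + y ^ 2))
  norm_eq : ∀ z ∈ rightHalfPlane, ‖V z‖ = ‖outerPart V z‖

end

/-! Since `V * W = (1 + z)^(-n)` has no zeros, neither has `V`, and `log |V|` is harmonic. Applying
`log a ≤ a` to both `|V|` and `|W|` gives `|log |V|| ≤ |V| + |W| + n log |1 + z|`
(`abs_log_norm_le`), so `log |V|` is bounded in `L²(dt / (1 + t²))` on the lines `Re z = x`,
uniformly for `0 < x < 1`. An `L²` bound, unlike an `L¹` bound, leaves no singular measure in the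
limit: `log |V|` is the Poisson integral of a function `φ`, and a singular inner factor is excluded.

`exists_radial_limit_of_poisson` carries this out. Each translate is the Poisson integral of its
values on the imaginary axis (`eq_integral_rightPoissonKernel`); a weak limit as `x ↓ 0` supplies
`φ`; Fatou's theorem identifies `φ` with the radial limit. Applied to `V` it gives the boundary
values, applied to `log |V|` it shows that their modulus is `exp φ`. As the real part of the kernel
of `O_V` is the Poisson kernel, `|V| = |O_V|`. -/

/-! ### The Poisson kernel: mass and decay -/

/-- The Poisson kernel of the right half-plane, with pole at the boundary point `it`. -/
noncomputable def rightPoissonKernel (z : ℂ) (t : ℝ) : ℝ :=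
  z.re / (z.re ^ 2 + (t - z.im) ^ 2) / Real.pi

lemma rightPoissonKernel_nonneg {z : ℂ} (hz : 0 < z.re) (t : ℝ) : 0 ≤ rightPoissonKernel z t := by
  unfold rightPoissonKernel
  have := Real.pi_pos
  positivity

lemma continuous_rightPoissonKernel {z : ℂ} (hz : 0 < z.re) :
    Continuous (rightPoissonKernel z) := by
  unfold rightPoissonKernel
  refine (Continuous.div (by fun_prop) (by fun_prop) fun t => ?_).div_const _
  positivity

lemma integral_rightPoissonKernel_smul {E : Type*} [NormedAddCommGroup E] [NormedSpace ℝ E]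
    {z : ℂ} (hz : 0 < z.re) (f : ℝ → E) :
    ∫ t, rightPoissonKernel z t • f t
      = ∫ s : ℝ, (1 / (1 + s ^ 2) / Real.pi) • f (z.im + z.re * s) := by
  have h1 := integral_add_left_eq_self (μ := (volume : Measure ℝ))
    (fun t => rightPoissonKernel z t • f t) z.im
  have h2 := Measure.integral_comp_mul_left
    (fun t => rightPoissonKernel z (z.im + t) • f (z.im + t)) z.re
  rw [h1, abs_of_pos (inv_pos.2 hz), eq_comm, inv_smul_eq_iff₀ hz.ne'] at h2
  rw [h2, ← integral_smul]
  congr 1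
  ext s
  rw [smul_smul]
  congr 1
  unfold rightPoissonKernel
  have : (0 : ℝ) < 1 + s ^ 2 := by positivity
  have e : z.re ^ 2 + (z.im + z.re * s - z.im) ^ 2 = z.re ^ 2 * (1 + s ^ 2) := by ring
  rw [e]
  have := Real.pi_pos
  field_simp

lemma integral_rightPoissonKernel {z : ℂ} (hz : 0 < z.re) :
    ∫ t, rightPoissonKernel z t = 1 := by
  have h := integral_rightPoissonKernel_smul hz (fun _ => (1 : ℝ))
  simp only [smul_eq_mul, mul_one, one_div] at h
  rw [h, integral_div, integral_univ_inv_one_add_sq, div_self Real.pi_ne_zero]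

/-- Rests on `1 + t² ≤ 1 + 2b² + 2(t - b)²`, the difference being `(t - 2b)²`. -/
lemma one_add_sq_le_mul {b d q t : ℝ} (hd : 0 < d) (hq : d ^ 2 ≤ q) (hq' : (t - b) ^ 2 ≤ q) :
    1 + t ^ 2 ≤ (2 + (1 + 2 * b ^ 2) / d ^ 2) * q := by
  have h1 : (1 + 2 * b ^ 2) ≤ (1 + 2 * b ^ 2) / d ^ 2 * q := by
    rw [div_mul_eq_mul_div, le_div_iff₀ (by positivity)]
    exact mul_le_mul_of_nonneg_left hq (by positivity)
  nlinarith [sq_nonneg (t - 2 * b)]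

/-- The factor `z.re` stays explicit: at distance `d` from `z.im` the kernel vanishes in the limit
`z.re → 0`. Taking `d = z.re` gives a bound for all `t`. -/
lemma rightPoissonKernel_le {z : ℂ} {d t : ℝ} (hz : 0 < z.re) (hd : 0 < d)
    (hq : d ^ 2 ≤ z.re ^ 2 + (t - z.im) ^ 2) :
    rightPoissonKernel z t
      ≤ z.re * ((2 + (1 + 2 * z.im ^ 2) / d ^ 2) / Real.pi) * (1 / (1 + t ^ 2)) := by
  have h := one_add_sq_le_mul hd hq (by nlinarith [sq_nonneg z.re] : (t - z.im) ^ 2 ≤ _)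
  have hpi := Real.pi_pos
  have e : z.re * ((2 + (1 + 2 * z.im ^ 2) / d ^ 2) / Real.pi) * (1 / (1 + t ^ 2))
      = z.re * ((2 + (1 + 2 * z.im ^ 2) / d ^ 2) / (1 + t ^ 2)) / Real.pi := by
    field_simp
  rw [e]
  unfold rightPoissonKernel
  gcongr ?_ / _
  rw [div_eq_mul_one_div]
  refine mul_le_mul_of_nonneg_left ?_ hz.le
  rw [div_le_div_iff₀ (by positivity) (by positivity)]
  linarith

lemma exists_rightPoissonKernel_le {z : ℂ} (hz : 0 < z.re) :
    ∃ C, 0 ≤ C ∧ ∀ t, rightPoissonKernel z t ≤ C * (1 / (1 + t ^ 2)) := by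
  have hpi := Real.pi_pos
  exact ⟨_, by positivity, fun t => rightPoissonKernel_le (t := t) hz hz
    (by nlinarith [sq_nonneg (t - z.im)])⟩

lemma integrable_rightPoissonKernel_smul {E : Type*} [NormedAddCommGroup E] [NormedSpace ℝ E]
    {z : ℂ} (hz : 0 < z.re) {φ : ℝ → E} (hφ : Integrable (fun t : ℝ => (1 / (1 + t ^ 2)) • φ t)) :
    Integrable (fun t => rightPoissonKernel z t • φ t) := by
  obtain ⟨C, hC, h⟩ := exists_rightPoissonKernel_le hz
  have e : (fun t => rightPoissonKernel z t • φ t)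
      = fun t => (rightPoissonKernel z t * (1 + t ^ 2)) • ((1 / (1 + t ^ 2)) • φ t) := by
    ext t
    have : (0 : ℝ) < 1 + t ^ 2 := by positivity
    rw [smul_smul]
    congr 1
    field_simp
  rw [e]
  refine hφ.bdd_smul C
    ((continuous_rightPoissonKernel hz).mul (by fun_prop)).aestronglyMeasurable
    (Eventually.of_forall fun t => ?_)
  have : (0 : ℝ) < 1 + t ^ 2 := by positivity
  rw [Real.norm_of_nonneg (mul_nonneg (rightPoissonKernel_nonneg hz t) this.le)]
  calc _ ≤ C * (1 / (1 + t ^ 2)) * (1 + t ^ 2) := by gcongr; exact h t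
    _ = C := by field_simp

lemma integrable_rightPoissonKernel {z : ℂ} (hz : 0 < z.re) :
    Integrable (rightPoissonKernel z) := by
  have := integrable_rightPoissonKernel_smul hz (φ := fun _ => (1 : ℝ))
    (by simpa using integrable_inv_one_add_sq)
  simpa using this

lemma lintegral_rightPoissonKernel {z : ℂ} (hz : 0 < z.re) :
    ∫⁻ t, ENNReal.ofReal (rightPoissonKernel z t) = 1 := by
  rw [← ofReal_integral_eq_lintegral_ofReal (integrable_rightPoissonKernel hz)
    (Eventually.of_forall (rightPoissonKernel_nonneg hz)), integral_rightPoissonKernel hz]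
  simp

/-! ### Lebesgue points and Fatou's theorem -/

/-- The Poisson kernel is a superposition of indicators of intervals centred at `z.im`, so a measure
that is small on all such intervals has small Poisson integral. -/
lemma lintegral_rightPoissonKernel_le {z : ℂ} (hz : 0 < z.re) (ν : Measure ℝ) (ε : ENNReal)
    (hν : ∀ r : ℝ, 0 ≤ r →
      ν (Metric.closedBall z.im r) ≤ ε * volume (Metric.closedBall z.im r)) :
    ∫⁻ t, ENNReal.ofReal (rightPoissonKernel z t) ∂ν ≤ ε := by
  have hm := (continuous_rightPoissonKernel hz).measurable
  -- Each superlevel set of the kernel is empty or a closed ball about `z.im`; the layer-cake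
  -- formula then compares the two integrals level by level.
  have key : ∀ l ∈ Set.Ioi (0 : ℝ), ν {t | l ≤ rightPoissonKernel z t}
      ≤ ε * volume {t | l ≤ rightPoissonKernel z t} := by
    intro l hl
    have hl : 0 < l := hl
    have hpi := Real.pi_pos
    have e : {t | l ≤ rightPoissonKernel z t}
        = {t | (t - z.im) ^ 2 ≤ z.re / (Real.pi * l) - z.re ^ 2} := by
      ext t
      simp only [Set.mem_ofPred_eq, rightPoissonKernel]
      rw [le_div_iff₀ hpi, le_div_iff₀ (by positivity), le_sub_iff_add_le,
        le_div_iff₀ (by positivity)]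
      constructor <;> intro h <;> linarith
    rw [e]
    rcases lt_or_ge (z.re / (Real.pi * l) - z.re ^ 2) 0 with h | h
    · have : {t : ℝ | (t - z.im) ^ 2 ≤ z.re / (Real.pi * l) - z.re ^ 2} = ∅ := by
        ext t
        simp only [Set.mem_ofPred_eq, Set.mem_empty_iff_false, iff_false, not_le]
        exact h.trans_le (sq_nonneg _)
      simp [this]
    · have : {t : ℝ | (t - z.im) ^ 2 ≤ z.re / (Real.pi * l) - z.re ^ 2}
          = Metric.closedBall z.im (√(z.re / (Real.pi * l) - z.re ^ 2)) := by
        ext t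
        simp only [Set.mem_ofPred_eq, Metric.mem_closedBall, Real.dist_eq]
        rw [← sq_abs, Real.le_sqrt (abs_nonneg _) h]
      rw [this]
      exact hν _ (Real.sqrt_nonneg _)
  have h0 := rightPoissonKernel_nonneg hz
  rw [lintegral_eq_lintegral_meas_le ν (Eventually.of_forall h0) hm.aemeasurable]
  calc _ ≤ ∫⁻ l in Set.Ioi (0 : ℝ), ε * volume {t | l ≤ rightPoissonKernel z t} :=
        setLIntegral_mono' measurableSet_Ioi key
    _ = ε * ∫⁻ l in Set.Ioi (0 : ℝ), volume {t | l ≤ rightPoissonKernel z t} := by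
        refine lintegral_const_mul _ (Antitone.measurable fun a b hab => ?_)
        exact measure_mono fun t ht => hab.trans ht
    _ = ε := by
        rw [← lintegral_eq_lintegral_meas_le volume (Eventually.of_forall h0) hm.aemeasurable,
          lintegral_rightPoissonKernel hz, mul_one]

lemma exists_pos_setLIntegral_le_of_tendsto_average {E : Type*} [NormedAddCommGroup E]
    {φ : ℝ → E} {y : ℝ} (hφ : LocallyIntegrable φ)
    (hy : Tendsto (fun δ => ⨍ t in Metric.closedBall y δ, ‖φ t - φ y‖) (𝓝[>] 0) (𝓝 0))
    {ε : ℝ} (hε : 0 < ε) :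
    ∃ δ > 0, ∀ r : ℝ, 0 ≤ r → r ≤ δ → ∫⁻ t in Metric.closedBall y r, ‖φ t - φ y‖ₑ
      ≤ ENNReal.ofReal ε * volume (Metric.closedBall y r) := by
  have h := hy.eventually (gt_mem_nhds hε)
  obtain ⟨δ, hδ, h⟩ := mem_nhdsGT_iff_exists_Ioc_subset.1 h
  refine ⟨δ, hδ, fun r hr0 hr => ?_⟩
  rcases hr0.eq_or_lt with rfl | hr0
  · simp
  have := h ⟨hr0, hr⟩
  simp only [Set.mem_ofPred_eq, setAverage_eq, smul_eq_mul] at this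
  have hv : 0 < volume.real (Metric.closedBall y r) := by
    rw [Real.volume_real_closedBall hr0.le]
    positivity
  rw [inv_mul_lt_iff₀ hv] at this
  have hInt : IntegrableOn (fun t => φ t - φ y) (Metric.closedBall y r) :=
    (hφ.integrableOn_isCompact (isCompact_closedBall _ _)).sub
      (continuousOn_const.integrableOn_compact (isCompact_closedBall _ _))
  rw [← ofReal_integral_norm_eq_lintegral_enorm hInt]
  refine (ENNReal.ofReal_le_ofReal this.le).trans ?_
  rw [mul_comm, ENNReal.ofReal_mul hε.le]
  gcongr
  rw [Measure.real, ENNReal.ofReal_toReal measure_closedBall_lt_top.ne]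

/-- **Fatou's theorem**: Poisson integrals converge radially almost everywhere. -/
theorem ae_tendsto_integral_rightPoissonKernel {E : Type*} [NormedAddCommGroup E]
    [NormedSpace ℝ E] [CompleteSpace E] {φ : ℝ → E}
    (hφ : Integrable (fun t : ℝ => (1 / (1 + t ^ 2)) • φ t)) :
    ∀ᵐ y : ℝ, Tendsto
      (fun x : ℝ => ∫ t, rightPoissonKernel ((x : ℂ) + (y : ℂ) * Complex.I) t • φ t)
      (𝓝[>] 0) (𝓝 (φ y)) := by
  have hloc : LocallyIntegrable φ := by
    have : φ = fun t : ℝ => (1 + t ^ 2) • ((1 / (1 + t ^ 2)) • φ t) := by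
      ext t
      have : (0 : ℝ) < 1 + t ^ 2 := by positivity
      rw [smul_smul, mul_one_div_cancel this.ne', one_smul]
    rw [this, ← locallyIntegrableOn_univ]
    exact (hφ.locallyIntegrable.locallyIntegrableOn _).continuousOn_smul
      isOpen_univ.isLocallyClosed (by fun_prop)
  filter_upwards [IsUnifLocDoublingMeasure.ae_tendsto_average_norm_sub volume hloc 1] with y hy
  have hy := hy (l := 𝓝[>] 0) (fun _ => y) id tendsto_id (by
    filter_upwards [self_mem_nhdsWithin] with δ hδ
    simpa using (le_of_lt hδ : (0 : ℝ) ≤ δ))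
  have hdiff : Integrable (fun t : ℝ => (1 / (1 + t ^ 2)) • (φ t - φ y)) := by
    simp only [smul_sub]
    refine hφ.sub ?_
    simpa using integrable_inv_one_add_sq.smul_const (φ y)
  set K : ENNReal := ∫⁻ t : ℝ, ‖(1 / (1 + t ^ 2)) • (φ t - φ y)‖ₑ with hK
  have hKtop : K < ⊤ := hdiff.2
  -- The kernel has mass one, so the error is the Poisson integral of `φ - φ y`, split below at
  -- distance `δ` from `y`.
  have hker : ∀ x : ℝ, 0 < x →
      (∫ t, rightPoissonKernel ((x : ℂ) + (y : ℂ) * Complex.I) t • φ t) - φ y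
      = ∫ t, rightPoissonKernel ((x : ℂ) + (y : ℂ) * Complex.I) t • (φ t - φ y) := by
    intro x hx
    have hz : 0 < ((x : ℂ) + (y : ℂ) * Complex.I).re := by simpa using hx
    simp only [smul_sub]
    rw [integral_sub (integrable_rightPoissonKernel_smul hz hφ)
      ((integrable_rightPoissonKernel hz).smul_const _), integral_smul_const,
      integral_rightPoissonKernel hz, one_smul]
  rw [tendsto_iff_norm_sub_tendsto_zero]
  rw [Metric.tendsto_nhds]
  intro ε hε
  obtain ⟨δ, hδ, hδr⟩ := exists_pos_setLIntegral_le_of_tendsto_average hloc hy (half_pos hε)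
  set D : ℝ := (2 + (1 + 2 * y ^ 2) / δ ^ 2) / Real.pi with hD
  have hDpos : 0 ≤ D := by have := Real.pi_pos; positivity
  have hlim : Tendsto (fun x : ℝ => x * D * K.toReal) (𝓝[>] 0) (𝓝 0) := by
    have : Tendsto (fun x : ℝ => x * D * K.toReal) (𝓝 0) (𝓝 (0 * D * K.toReal)) :=
      Continuous.tendsto (by fun_prop) 0
    simpa using this.mono_left nhdsWithin_le_nhds
  filter_upwards [hlim.eventually (gt_mem_nhds (half_pos hε)), self_mem_nhdsWithin] with x hx1 hx
  have hx : 0 < x := hx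
  rw [dist_zero_right, norm_norm, hker x hx]
  set z : ℂ := (x : ℂ) + (y : ℂ) * Complex.I with hzdef
  have hre : z.re = x := by simp [hzdef]
  have him : z.im = y := by simp [hzdef]
  have hz : 0 < z.re := by rw [hre]; exact hx
  have hmeas : AEMeasurable (fun t => ‖φ t - φ y‖ₑ) :=
    (hloc.aestronglyMeasurable.sub aestronglyMeasurable_const).enorm
  -- Near part: the measure with density `‖φ - φ y‖` on the ball is small on every centred ball, by
  -- the choice of `δ`.
  have hin : ∫⁻ t in Metric.closedBall y δ,
      ‖rightPoissonKernel z t • (φ t - φ y)‖ₑ ≤ ENNReal.ofReal (ε / 2) := by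
    have := lintegral_rightPoissonKernel_le hz
      ((volume.restrict (Metric.closedBall y δ)).withDensity (fun t => ‖φ t - φ y‖ₑ))
      (ENNReal.ofReal (ε / 2)) (by
        intro r hr
        rw [him, withDensity_apply _ Metric.isClosed_closedBall.measurableSet,
          Measure.restrict_restrict Metric.isClosed_closedBall.measurableSet]
        have e : Metric.closedBall y r ∩ Metric.closedBall y δ = Metric.closedBall y (min r δ) := by
          ext t
          simp
        rw [e]
        refine (hδr _ (le_min hr hδ.le) (min_le_right _ _)).trans ?_
        gcongr
        exact min_le_left _ _)
    rw [lintegral_withDensity_eq_lintegral_mul₀ hmeas.restrict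
      (continuous_rightPoissonKernel hz).measurable.ennreal_ofReal.aemeasurable] at this
    refine le_of_eq_of_le (lintegral_congr fun t => ?_) this
    rw [enorm_smul, Pi.mul_apply, mul_comm, Real.enorm_of_nonneg (rightPoissonKernel_nonneg hz t)]
  -- Far part: the kernel is at most `x * D / (1 + t²)`, which tends to zero with `x`.
  have hout : ∫⁻ t in (Metric.closedBall y δ)ᶜ,
      ‖rightPoissonKernel z t • (φ t - φ y)‖ₑ ≤ ENNReal.ofReal (x * D) * K := by
    rw [hK, ← lintegral_const_mul' _ _ ENNReal.ofReal_ne_top]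
    refine (setLIntegral_mono' (Metric.isClosed_closedBall.measurableSet.compl)
      fun t ht => ?_).trans (setLIntegral_le_lintegral _ _)
    rw [Set.mem_compl_iff, Metric.mem_closedBall, not_le, Real.dist_eq] at ht
    have hle := rightPoissonKernel_le (t := t) hz hδ (by
      rw [him, ← sq_abs (t - y)]
      nlinarith [sq_nonneg z.re])
    rw [hre, him] at hle
    rw [enorm_smul, enorm_smul, ← mul_assoc,
      Real.enorm_of_nonneg (rightPoissonKernel_nonneg hz t), Real.enorm_of_nonneg (by positivity),
      ← ENNReal.ofReal_mul (by positivity)]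
    gcongr
  have htot : ‖∫ t, rightPoissonKernel z t • (φ t - φ y)‖ₑ
      ≤ ENNReal.ofReal (ε / 2) + ENNReal.ofReal (x * D) * K := by
    refine (enorm_integral_le_lintegral_enorm _).trans ?_
    rw [← lintegral_add_compl _ (Metric.isClosed_closedBall (x := y) (ε := δ)).measurableSet]
    exact add_le_add hin hout
  rw [← ENNReal.ofReal_toReal hKtop.ne, ← ENNReal.ofReal_mul (by positivity),
    ← ENNReal.ofReal_add (by positivity) (by positivity), ← ofReal_norm,
    ENNReal.ofReal_le_ofReal_iff (by positivity)] at htot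
  linarith

/-! ### Transfer to the disc and Poisson's formula -/

/-- With `a = arctan s`, both sides are `-r (cos a - i sin a)²`. Under this parametrisation `dθ /
2π` becomes `ds / (π (1 + s²))`. -/
lemma circleMap_pi_sub_two_mul_arctan (r s : ℝ) :
    circleMap 0 r (Real.pi - 2 * Real.arctan s)
      = r * ((s * Complex.I - 1) / (s * Complex.I + 1)) := by
  have hne : (s : ℂ) * Complex.I + 1 ≠ 0 := by
    intro h
    have := congrArg Complex.re h
    simp at this
  have hcos : (Real.cos (Real.arctan s) : ℂ) ^ 2 * (1 + (s : ℂ) ^ 2) = 1 := by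
    have : Real.cos (Real.arctan s) ^ 2 * (1 + s ^ 2) = 1 := by
      rw [Real.cos_sq_arctan]
      have : (0 : ℝ) < 1 + s ^ 2 := by positivity
      field_simp
    exact_mod_cast this
  have hsin : (Real.sin (Real.arctan s) : ℂ) = s * Real.cos (Real.arctan s) := by
    have : Real.sin (Real.arctan s) = s * Real.cos (Real.arctan s) := by
      rw [Real.sin_arctan, Real.cos_arctan]
      ring
    exact_mod_cast this
  have hexp : Complex.exp (((Real.pi - 2 * Real.arctan s : ℝ) : ℂ) * Complex.I)
      = -(Real.cos (Real.arctan s) - Real.sin (Real.arctan s) * Complex.I : ℂ) ^ 2 := by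
    have e : ((Real.pi - 2 * Real.arctan s : ℝ) : ℂ) * Complex.I
        = Real.pi * Complex.I + ((2 : ℕ) : ℂ) * (((-Real.arctan s : ℝ) : ℂ) * Complex.I) := by
      push_cast
      ring
    rw [e, Complex.exp_add, Complex.exp_pi_mul_I, Complex.exp_nat_mul,
      Complex.exp_mul_I, ← Complex.ofReal_cos, ← Complex.ofReal_sin, Real.cos_neg, Real.sin_neg]
    push_cast
    ring
  rw [circleMap, hexp, zero_add, hsin]
  congr 1
  rw [eq_div_iff hne]
  linear_combination (s * Complex.I - 1) * hcos
    + (Real.cos (Real.arctan s) : ℂ) ^ 2 * (s ^ 2 - s ^ 3 * Complex.I) * Complex.I_sq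

lemma image_pi_sub_two_mul_arctan :
    (fun s : ℝ => Real.pi - 2 * Real.arctan s) '' Set.univ = Set.Ioo 0 (2 * Real.pi) := by
  ext θ
  simp only [Set.image_univ, Set.mem_range, Set.mem_Ioo]
  constructor
  · rintro ⟨s, rfl⟩
    have := Real.arctan_lt_pi_div_two s
    have := Real.neg_pi_div_two_lt_arctan s
    constructor <;> linarith
  · rintro ⟨h1, h2⟩
    refine ⟨Real.tan ((Real.pi - θ) / 2), ?_⟩
    rw [Real.arctan_tan (by linarith) (by linarith)]
    ring

/-- The circle average as an integral over the line, in the coordinate `w = (is - 1) / (is + 1)`. -/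
lemma circleAverage_zero_eq_integral {E : Type*} [NormedAddCommGroup E] [NormedSpace ℝ E]
    (f : ℂ → E) (r : ℝ) :
    Real.circleAverage f 0 r = ∫ s : ℝ, (1 / (1 + s ^ 2) / Real.pi) •
      f (r * ((s * Complex.I - 1) / (s * Complex.I + 1))) := by
  have hd : ∀ s ∈ (Set.univ : Set ℝ), HasDerivWithinAt
      (fun s : ℝ => Real.pi - 2 * Real.arctan s) (-(2 * (1 / (1 + s ^ 2)))) Set.univ s := by
    intro s _
    exact (((Real.hasDerivAt_arctan s).const_mul 2).const_sub _).hasDerivWithinAt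
  have hinj : Set.InjOn (fun s : ℝ => Real.pi - 2 * Real.arctan s) Set.univ := by
    intro a _ b _ h
    have h : Real.pi - 2 * Real.arctan a = Real.pi - 2 * Real.arctan b := h
    exact Real.arctan_injective (by linarith)
  rw [Real.circleAverage_def, intervalIntegral.integral_of_le (by positivity),
    integral_Ioc_eq_integral_Ioo, ← image_pi_sub_two_mul_arctan,
    integral_image_eq_integral_abs_deriv_smul MeasurableSet.univ hd hinj, setIntegral_univ,
    ← integral_smul]
  congr 1
  ext s
  rw [smul_smul, circleMap_pi_sub_two_mul_arctan, abs_neg, abs_of_nonneg (by positivity)]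
  congr 1
  have := Real.pi_pos
  field_simp

/-- The conformal map of the unit disc onto the right half-plane that sends `0` to `z`. -/
noncomputable def discToHalfPlane (z w : ℂ) : ℂ := z.im * Complex.I + z.re * ((1 + w) / (1 - w))

lemma discToHalfPlane_re {z w : ℂ} :
    (discToHalfPlane z w).re = z.re * ((1 - Complex.normSq w) / Complex.normSq (1 - w)) := by
  have : (discToHalfPlane z w).re = z.re * ((1 + w) / (1 - w)).re := by simp [discToHalfPlane]
  rw [this, Complex.div_re, ← add_div]
  congr 2
  simp [Complex.normSq_apply]
  ring

lemma discToHalfPlane_re_pos {z w : ℂ} (hz : 0 < z.re) (hw : ‖w‖ < 1) :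
    0 < (discToHalfPlane z w).re := by
  rw [discToHalfPlane_re]
  have h1 : 0 < 1 - Complex.normSq w := by
    rw [Complex.normSq_eq_norm_sq]
    nlinarith [norm_nonneg w]
  have h2 : 0 < Complex.normSq (1 - w) := by
    rw [Complex.normSq_pos, sub_ne_zero]
    rintro rfl
    simp at hw
  positivity

/-- The exponent is that of the weight `(1 + s²)^(-1)` times square-root growth `(1 + s²)^(1/4)`. -/
lemma integrable_one_add_sq_rpow : Integrable (fun s : ℝ => (1 + s ^ 2) ^ (-(3 / 4) : ℝ)) := by
  have h := integrable_rpow_neg_one_add_norm_sq (E := ℝ) (μ := volume) (r := 3 / 2)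
    (by norm_num)
  refine h.congr (Eventually.of_forall fun s => ?_)
  simp only [Real.norm_eq_abs, sq_abs]
  norm_num

lemma one_div_one_add_sq_mul_rpow (s : ℝ) :
    1 / (1 + s ^ 2) * (1 + s ^ 2) ^ (1 / 4 : ℝ) = (1 + s ^ 2) ^ (-(3 / 4) : ℝ) := by
  have : (0 : ℝ) < 1 + s ^ 2 := by positivity
  rw [one_div, ← Real.rpow_neg_one, ← Real.rpow_add this]
  norm_num

/-- **Poisson's formula** for the right half-plane: a function continuous on the closed half-plane,
growing at most like a square root, and with the mean value property at `z` after transfer to the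
disc, is at `z` the Poisson integral of its boundary values. -/
theorem eq_integral_rightPoissonKernel {E : Type*} [NormedAddCommGroup E] [NormedSpace ℝ E]
    [CompleteSpace E] {u : ℂ → E} {z : ℂ} (hz : 0 < z.re)
    (hc : ContinuousOn u {w | 0 ≤ w.re}) {C : ℝ}
    (hC : ∀ w : ℂ, 0 ≤ w.re → ‖u w‖ ≤ C * (1 + ‖w‖) ^ (1 / 2 : ℝ))
    (hm : ∀ r ∈ Set.Ioo (0 : ℝ) 1,
      Real.circleAverage (fun w => u (discToHalfPlane z w)) 0 r = u z) :
    u z = ∫ t : ℝ, rightPoissonKernel z t • u (t * Complex.I) := by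
  have hC0 : 0 ≤ C := by
    have := (norm_nonneg _).trans (hC 0 (by simp))
    simpa using this
  let w : ℝ → ℂ := fun s => (s * Complex.I - 1) / (s * Complex.I + 1)
  have hne : ∀ s : ℝ, (s : ℂ) * Complex.I + 1 ≠ 0 := by
    intro s h
    have := congrArg Complex.re h
    simp at this
  have hnsq : ∀ s : ℝ, ‖(s : ℂ) * Complex.I + 1‖ = √(1 + s ^ 2) := by
    intro s
    rw [Complex.norm_def, Complex.normSq_apply]
    congr 1
    simp
    ring
  have hw1 : ∀ s, ‖w s‖ = 1 := by
    intro s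
    have : ‖(s : ℂ) * Complex.I - 1‖ = √(1 + s ^ 2) := by
      rw [Complex.norm_def, Complex.normSq_apply]
      congr 1
      simp
      ring
    rw [norm_div, this, hnsq, div_self]
    positivity
  have hw2 : ∀ s, 1 - w s = 2 / (s * Complex.I + 1) := by
    intro s
    have := hne s
    simp only [w]
    field_simp
    ring
  have hwc : Continuous w := by
    refine Continuous.div (by fun_prop) (by fun_prop) hne
  have hrw : ∀ r ∈ Set.Ioo (0 : ℝ) 1, ∀ s, ‖(r : ℂ) * w s‖ < 1 := by
    intro r hr s
    rw [norm_mul, hw1, Complex.norm_real, Real.norm_of_nonneg hr.1.le, mul_one]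
    exact hr.2
  have hrw' : ∀ r ∈ Set.Ioo (0 : ℝ) 1, ∀ s, 1 - (r : ℂ) * w s ≠ 0 := by
    intro r hr s h
    have h1 := hrw r hr s
    rw [← sub_eq_zero.1 h] at h1
    simp at h1
  -- Uniform in `r`, since `|1 - w| ≤ |1 - r w| + (1 - r) ≤ 2 |1 - r w|`. It keeps the pole of the
  -- conformal map at `1` under control as `r → 1`.
  have hlow : ∀ r ∈ Set.Ioo (0 : ℝ) 1, ∀ s, 1 / √(1 + s ^ 2) ≤ ‖1 - (r : ℂ) * w s‖ := by
    intro r hr s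
    have h1 : ‖1 - w s‖ = 2 / √(1 + s ^ 2) := by
      rw [hw2, norm_div, hnsq]
      simp
    have h2 : ‖1 - w s‖ ≤ ‖1 - (r : ℂ) * w s‖ + (1 - r) := by
      have e : 1 - w s = (1 - (r : ℂ) * w s) - ((1 - r : ℝ) : ℂ) * w s := by
        push_cast
        ring
      rw [e]
      refine (norm_sub_le _ _).trans ?_
      rw [norm_mul, hw1, Complex.norm_real, Real.norm_of_nonneg (by linarith [hr.2]), mul_one]
    have h3 : 1 - r ≤ ‖1 - (r : ℂ) * w s‖ := by
      have := norm_sub_norm_le (1 : ℂ) ((r : ℂ) * w s)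
      rw [norm_mul, hw1, Complex.norm_real, Real.norm_of_nonneg hr.1.le, mul_one, norm_one] at this
      exact this
    have h4 : 1 / √(1 + s ^ 2) = (2 / √(1 + s ^ 2)) / 2 := by ring
    rw [h4, ← h1]
    linarith
  set B : ℝ := 1 + |z.im| + 2 * z.re with hB
  have hB0 : 0 ≤ B := by positivity
  have hbound : ∀ r ∈ Set.Ioo (0 : ℝ) 1, ∀ s,
      1 + ‖discToHalfPlane z (r * w s)‖ ≤ B * √(1 + s ^ 2) := by
    intro r hr s
    have hs : 1 ≤ √(1 + s ^ 2) := Real.one_le_sqrt.2 (by nlinarith [sq_nonneg s])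
    have h1 : ‖(1 + (r : ℂ) * w s) / (1 - (r : ℂ) * w s)‖ ≤ 2 * √(1 + s ^ 2) := by
      rw [norm_div, div_le_iff₀ (norm_pos_iff.2 (hrw' r hr s))]
      have h2 : ‖1 + (r : ℂ) * w s‖ ≤ 2 := by
        refine (norm_add_le _ _).trans ?_
        rw [norm_one]
        linarith [hrw r hr s]
      have h3 := hlow r hr s
      rw [div_le_iff₀ (by positivity)] at h3
      nlinarith
    have h2 : ‖discToHalfPlane z (r * w s)‖ ≤ |z.im| + z.re * (2 * √(1 + s ^ 2)) := by
      unfold discToHalfPlane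
      refine (norm_add_le _ _).trans ?_
      rw [norm_mul, norm_mul, Complex.norm_I, mul_one, Complex.norm_real, Complex.norm_real,
        Real.norm_eq_abs, Real.norm_of_nonneg hz.le]
      gcongr
    rw [hB]
    nlinarith [abs_nonneg z.im]
  -- Let `r → 1` in the mean value property, by dominated convergence; the circle is carried to the
  -- imaginary axis.
  have hlim : Tendsto (fun r : ℝ => ∫ s : ℝ, (1 / (1 + s ^ 2) / Real.pi) •
      u (discToHalfPlane z (r * w s))) (𝓝[<] 1)
      (𝓝 (∫ s : ℝ, (1 / (1 + s ^ 2) / Real.pi) • u (((z.im + z.re * s : ℝ) : ℂ) * Complex.I))) := by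
    have hev : ∀ᶠ r : ℝ in 𝓝[<] 1, r ∈ Set.Ioo (0 : ℝ) 1 := Ioo_mem_nhdsLT one_pos
    refine tendsto_integral_filter_of_dominated_convergence
      (fun s => C * B ^ (1 / 2 : ℝ) / Real.pi * (1 + s ^ 2) ^ (-(3 / 4) : ℝ)) ?_ ?_ ?_ ?_
    · filter_upwards [hev] with r hr
      refine Continuous.aestronglyMeasurable ?_
      refine Continuous.smul ?_ ?_
      · refine (Continuous.div (by fun_prop) (by fun_prop) fun s => ?_).div_const _
        positivity
      · refine hc.comp_continuous ?_ fun s => (discToHalfPlane_re_pos hz (hrw r hr s)).le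
        unfold discToHalfPlane
        exact continuous_const.add (continuous_const.mul
          (Continuous.div (by fun_prop) (by fun_prop) (hrw' r hr)))
    · filter_upwards [hev] with r hr
      refine Eventually.of_forall fun s => ?_
      have hpi := Real.pi_pos
      rw [norm_smul, Real.norm_of_nonneg (by positivity)]
      have h1 : ‖u (discToHalfPlane z (r * w s))‖
          ≤ C * (B ^ (1 / 2 : ℝ) * (1 + s ^ 2) ^ (1 / 4 : ℝ)) := by
        refine (hC _ (discToHalfPlane_re_pos hz (hrw r hr s)).le).trans ?_
        gcongr
        refine (Real.rpow_le_rpow (by positivity) (hbound r hr s) (by norm_num)).trans ?_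
        rw [Real.mul_rpow hB0 (by positivity), Real.sqrt_eq_rpow, ← Real.rpow_mul (by positivity)]
        norm_num
      calc _ ≤ 1 / (1 + s ^ 2) / Real.pi * (C * (B ^ (1 / 2 : ℝ) * (1 + s ^ 2) ^ (1 / 4 : ℝ))) := by
            gcongr
        _ = C * B ^ (1 / 2 : ℝ) / Real.pi * (1 / (1 + s ^ 2) * (1 + s ^ 2) ^ (1 / 4 : ℝ)) := by
            ring
        _ = _ := by rw [one_div_one_add_sq_mul_rpow]
    · exact integrable_one_add_sq_rpow.const_mul _
    · refine Eventually.of_forall fun s => Tendsto.const_smul ?_ _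
      have hval : discToHalfPlane z (((1 : ℝ) : ℂ) * w s)
          = ((z.im + z.re * s : ℝ) : ℂ) * Complex.I := by
        have h2 : 1 + w s = 2 * (s * Complex.I) / (s * Complex.I + 1) := by
          have := hne s
          simp only [w]
          field_simp
          ring
        have h3 := hne s
        rw [Complex.ofReal_one, one_mul, discToHalfPlane, hw2, h2, div_div_div_cancel_right₀ h3,
          mul_div_cancel_left₀ _ two_ne_zero]
        push_cast
        ring
      have hcont : ContinuousAt (fun r : ℝ => discToHalfPlane z (r * w s)) 1 := by
        unfold discToHalfPlane
        refine continuousAt_const.add (continuousAt_const.mul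
          (ContinuousAt.div (by fun_prop) (by fun_prop) ?_))
        rw [Complex.ofReal_one, one_mul, hw2]
        exact div_ne_zero two_ne_zero (hne s)
      have hu := hc (((z.im + z.re * s : ℝ) : ℂ) * Complex.I) (by simp)
      refine Tendsto.comp (hu : Tendsto u _ _) (tendsto_nhdsWithin_iff.2 ⟨?_, ?_⟩)
      · rw [← hval]
        exact hcont.tendsto.mono_left nhdsWithin_le_nhds
      · filter_upwards [hev] with r hr
        exact (discToHalfPlane_re_pos hz (hrw r hr s)).le
  rw [integral_rightPoissonKernel_smul hz (fun t : ℝ => u (t * Complex.I))]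
  refine tendsto_nhds_unique (tendsto_const_nhds.congr' ?_) hlim
  filter_upwards [Ioo_mem_nhdsLT one_pos] with r hr
  rw [← hm r hr, circleAverage_zero_eq_integral]

/-! ### Weak limits in `L²(dt / (1 + t²))` -/

/-- The measure `dt / (1 + t²)` on the line. -/
noncomputable def cauchyWeight : Measure ℝ :=
  volume.withDensity fun t => ENNReal.ofReal (1 / (1 + t ^ 2))

lemma measurable_cauchyWeight_density :
    Measurable fun t : ℝ => ENNReal.ofReal (1 / (1 + t ^ 2)) := by
  fun_prop

instance : IsFiniteMeasure cauchyWeight := by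
  refine isFiniteMeasure_withDensity_ofReal ?_
  simpa using integrable_inv_one_add_sq.2

lemma integral_cauchyWeight {E : Type*} [NormedAddCommGroup E] [NormedSpace ℝ E] (f : ℝ → E) :
    ∫ t, f t ∂cauchyWeight = ∫ t : ℝ, (1 / (1 + t ^ 2)) • f t := by
  rw [cauchyWeight, integral_withDensity_eq_integral_toReal_smul measurable_cauchyWeight_density
    (by simp)]
  congr 1
  ext t
  rw [ENNReal.toReal_ofReal (by positivity)]

lemma integrable_cauchyWeight_iff {E : Type*} [NormedAddCommGroup E] [NormedSpace ℝ E]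
    {f : ℝ → E} :
    Integrable f cauchyWeight ↔ Integrable fun t : ℝ => (1 / (1 + t ^ 2)) • f t := by
  rw [cauchyWeight, integrable_withDensity_iff_integrable_smul' measurable_cauchyWeight_density
    (by simp)]
  refine integrable_congr (Eventually.of_forall fun t => ?_)
  simp only
  rw [ENNReal.toReal_ofReal (by positivity)]

/-- Relative to the weight the kernel is bounded, hence square integrable; so Poisson integration is
an inner product and passes to weak limits. -/
lemma memLp_rightPoissonKernel_mul {z : ℂ} (hz : 0 < z.re) :
    MemLp (fun t : ℝ => ((rightPoissonKernel z t * (1 + t ^ 2) : ℝ) : ℂ)) 2 cauchyWeight := by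
  obtain ⟨C, hC, h⟩ := exists_rightPoissonKernel_le hz
  refine MemLp.of_bound (C := C) (Continuous.aestronglyMeasurable ?_)
    (Eventually.of_forall fun t => ?_)
  · exact Complex.continuous_ofReal.comp ((continuous_rightPoissonKernel hz).mul (by fun_prop))
  · have : (0 : ℝ) < 1 + t ^ 2 := by positivity
    rw [Complex.norm_real,
      Real.norm_of_nonneg (mul_nonneg (rightPoissonKernel_nonneg hz t) this.le)]
    calc _ ≤ C * (1 / (1 + t ^ 2)) * (1 + t ^ 2) := by gcongr; exact h t
      _ = C := by field_simp

lemma inner_rightPoissonKernel_mul {z : ℂ} (hz : 0 < z.re) (f : Lp ℂ 2 cauchyWeight) {φ : ℝ → ℂ}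
    (hφ : f =ᵐ[cauchyWeight] φ) :
    inner ℂ (memLp_rightPoissonKernel_mul hz).toLp f
      = ∫ t, rightPoissonKernel z t • φ t := by
  rw [L2.inner_def]
  have e : ∀ᵐ t ∂cauchyWeight, inner ℂ ((memLp_rightPoissonKernel_mul hz).toLp _ t) (f t)
      = (rightPoissonKernel z t * (1 + t ^ 2)) • φ t := by
    filter_upwards [(memLp_rightPoissonKernel_mul hz).coeFn_toLp, hφ] with t h1 h2
    rw [h1, h2, RCLike.inner_apply, Complex.conj_ofReal, Complex.real_smul, mul_comm]
  rw [integral_congr_ae e, integral_cauchyWeight]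
  congr 1
  ext t
  rw [smul_smul]
  congr 1
  have : (0 : ℝ) < 1 + t ^ 2 := by positivity
  field_simp

/-- A bounded family in a Hilbert space has a weak limit along some ultrafilter. -/
lemma exists_ultrafilter_tendsto_inner {ι H : Type*} [NormedAddCommGroup H]
    [InnerProductSpace ℂ H] [CompleteSpace H] {l : Filter ι} [l.NeBot] {G : ι → H} {C : ℝ}
    (hG : ∀ᶠ i in l, ‖G i‖ ≤ C) :
    ∃ (U : Ultrafilter ι) (Φ : H), ↑U ≤ l ∧
      ∀ g : H, Tendsto (fun i => inner ℂ g (G i)) U (𝓝 (inner ℂ g Φ)) := by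
  let U : Ultrafilter ι := Ultrafilter.of l
  have hU : (U : Filter ι) ≤ l := Ultrafilter.of_le l
  -- Riesz duality and Banach–Alaoglu. The functional pairs as `inner (G i) g`, hence the
  -- conjugation below.
  let L : ι → WeakDual ℂ H := fun i => StrongDual.toWeakDual (InnerProductSpace.toDual ℂ H (G i))
  obtain ⟨ℓ, -, hℓ⟩ := (WeakDual.isCompact_closedBall (𝕜 := ℂ) (E := H) 0 C).ultrafilter_le_nhds
    (U.map L) (by
      rw [le_principal_iff]
      have : ∀ᶠ i in (U : Filter ι),
          L i ∈ WeakDual.toStrongDual ⁻¹' Metric.closedBall (0 : StrongDual ℂ H) C := by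
        filter_upwards [hU hG] with i hi
        rw [Set.mem_preimage, mem_closedBall_zero_iff]
        exact ((InnerProductSpace.toDual ℂ H).norm_map (G i)).trans_le hi
      exact this)
  refine ⟨U, (InnerProductSpace.toDual ℂ H).symm (WeakDual.toStrongDual ℓ), hU, fun g => ?_⟩
  have h1 : Tendsto (fun i => L i g) U (𝓝 (ℓ g)) :=
    ((WeakDual.eval_continuous g).tendsto ℓ).comp hℓ
  have h2 := (Complex.continuous_conj.tendsto _).comp h1
  have e : ∀ i, (starRingEnd ℂ) (L i g) = inner ℂ g (G i) := fun i => by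
    rw [← inner_conj_symm]
    rfl
  have e' : (starRingEnd ℂ) (ℓ g)
      = inner ℂ g ((InnerProductSpace.toDual ℂ H).symm (WeakDual.toStrongDual ℓ)) := by
    rw [← inner_conj_symm, InnerProductSpace.toDual_symm_apply]
    rfl
  rw [← e']
  exact h2.congr e

/-- If the translates `h (x + ·)` are Poisson integrals of their boundary values and stay bounded in
`L²(dt / (1 + t²))`, then `h` is the Poisson integral of a function which is its radial boundary
value almost everywhere. -/
theorem exists_radial_limit_of_poisson {h : ℂ → ℂ} (hc : ContinuousOn h rightHalfPlane) {C : ℝ}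
    (hC : ∀ x ∈ Set.Ioo (0 : ℝ) 1,
      eLpNorm (fun t : ℝ => h (x + t * Complex.I)) 2 cauchyWeight ≤ ENNReal.ofReal C)
    (hP : ∀ x ∈ Set.Ioo (0 : ℝ) 1, ∀ z : ℂ, 0 < z.re →
      h (x + z) = ∫ t : ℝ, rightPoissonKernel z t • h (x + t * Complex.I)) :
    ∃ φ : ℝ → ℂ, (Integrable fun t : ℝ => (1 / (1 + t ^ 2)) • φ t) ∧
      (∀ z : ℂ, 0 < z.re → h z = ∫ t : ℝ, rightPoissonKernel z t • φ t) ∧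
      ∀ᵐ y : ℝ, Tendsto (fun x : ℝ => h (x + y * Complex.I)) (𝓝[>] 0) (𝓝 (φ y)) := by
  classical
  have hmem : ∀ x ∈ Set.Ioo (0 : ℝ) 1,
      MemLp (fun t : ℝ => h (x + t * Complex.I)) 2 cauchyWeight := by
    intro x hx
    refine ⟨Continuous.aestronglyMeasurable ?_, (hC x hx).trans_lt ENNReal.ofReal_lt_top⟩
    exact hc.comp_continuous (by fun_prop) fun t => by simpa [rightHalfPlane] using hx.1
  let G : ℝ → Lp ℂ 2 cauchyWeight := fun x =>
    if hx : x ∈ Set.Ioo (0 : ℝ) 1 then (hmem x hx).toLp else 0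
  have hev : ∀ᶠ x : ℝ in 𝓝[>] 0, x ∈ Set.Ioo (0 : ℝ) 1 := Ioo_mem_nhdsGT one_pos
  have hGn : ∀ᶠ x : ℝ in 𝓝[>] 0, ‖G x‖ ≤ max C 0 := by
    filter_upwards [hev] with x hx
    simp only [G, dif_pos hx, Lp.norm_toLp]
    refine ENNReal.toReal_le_of_le_ofReal (le_max_right _ _) ((hC x hx).trans ?_)
    exact ENNReal.ofReal_le_ofReal (le_max_left _ _)
  obtain ⟨U, Φ, hU, hΦ⟩ := exists_ultrafilter_tendsto_inner hGn
  have hInt : Integrable fun t : ℝ => (1 / (1 + t ^ 2)) • Φ t :=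
    integrable_cauchyWeight_iff.1 ((Lp.memLp Φ).integrable (by norm_num))
  have hrep : ∀ z : ℂ, 0 < z.re → h z = ∫ t : ℝ, rightPoissonKernel z t • Φ t := by
    intro z hz
    have h1 := hΦ (memLp_rightPoissonKernel_mul hz).toLp
    rw [inner_rightPoissonKernel_mul hz Φ (EventuallyEq.refl _ _)] at h1
    -- Along `U`, `h (x + z)` tends to `h z` by continuity and to the Poisson integral of `Φ` by
    -- weak convergence.
    refine tendsto_nhds_unique ?_ h1
    have hzc : ContinuousAt h z := hc.continuousAt
      ((isOpen_lt continuous_const Complex.continuous_re).mem_nhds hz)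
    have h2 : Tendsto (fun x : ℝ => h (x + z)) (𝓝[>] 0) (𝓝 (h z)) := by
      refine hzc.tendsto.comp ?_
      have : Tendsto (fun x : ℝ => (x : ℂ) + z) (𝓝 0) (𝓝 (((0 : ℝ) : ℂ) + z)) :=
        Continuous.tendsto (by fun_prop) 0
      simpa using this.mono_left nhdsWithin_le_nhds
    refine (h2.mono_left hU).congr' ?_
    filter_upwards [hU hev] with x hx
    rw [hP x hx z hz, inner_rightPoissonKernel_mul hz]
    simp only [G, dif_pos hx]
    exact (hmem x hx).coeFn_toLp
  refine ⟨Φ, hInt, hrep, ?_⟩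
  filter_upwards [ae_tendsto_integral_rightPoissonKernel hInt] with y hy
  refine hy.congr' ?_
  filter_upwards [self_mem_nhdsWithin] with x hx
  rw [hrep]
  simpa using hx

/-! ### `H²` functions: bounds and Poisson representation -/

lemma two_pi_mul_enorm_le_lintegral_circle {f : ℂ → ℂ} {c : ℂ} {R r : ℝ}
    (hf : DifferentiableOn ℂ f (Metric.ball c R)) (hr : 0 < r) (hrR : r < R) :
    ENNReal.ofReal (2 * Real.pi) * ‖f c‖ₑ
      ≤ ∫⁻ θ in Set.Ioo (-Real.pi) Real.pi, ‖f (c + r * (Real.cos θ + Real.sin θ * Complex.I))‖ₑ := by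
  have hpi := Real.pi_pos
  have hd : DiffContOnCl ℂ f (Metric.ball c |r|) := by
    rw [abs_of_pos hr]
    refine DifferentiableOn.diffContOnCl (hf.mono ?_)
    rw [closure_ball _ hr.ne']
    exact Metric.closedBall_subset_ball hrR
  have h := hd.circleAverage
  rw [Real.circleAverage_eq_integral_add (-Real.pi),
    intervalIntegral.integral_comp_add_right (fun θ => f (circleMap c r θ))] at h
  have e1 : (0 : ℝ) + -Real.pi = -Real.pi := by ring
  have e2 : 2 * Real.pi + -Real.pi = Real.pi := by ring
  rw [e1, e2, inv_smul_eq_iff₀ (by positivity),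
    intervalIntegral.integral_of_le (by linarith), integral_Ioc_eq_integral_Ioo] at h
  have h' := enorm_integral_le_lintegral_enorm (μ := volume.restrict (Set.Ioo (-Real.pi) Real.pi))
    (fun θ => f (circleMap c r θ))
  rw [h, enorm_smul, Real.enorm_of_nonneg (by positivity)] at h'
  refine h'.trans_eq (lintegral_congr fun θ => ?_)
  rw [circleMap, Complex.exp_mul_I, Complex.ofReal_cos, Complex.ofReal_sin]

lemma mul_enorm_le_setLIntegral_ball {f : ℂ → ℂ} {c : ℂ} {R : ℝ} (hR : 0 < R)
    (hf : DifferentiableOn ℂ f (Metric.ball c R)) :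
    ENNReal.ofReal (Real.pi * R ^ 2 / 2) * ‖f c‖ₑ
      ≤ ∫⁻ p in Metric.ball (0 : ℂ) R, ‖f (c + p)‖ₑ := by
  have hpi := Real.pi_pos
  let g : ℂ → ENNReal := (Metric.ball (0 : ℂ) R).indicator fun p => ‖f (c + p)‖ₑ
  have hg : Measurable g := by
    have hcont : ContinuousOn (fun p => f (c + p)) (Metric.ball (0 : ℂ) R) := by
      refine hf.continuousOn.comp (by fun_prop) fun p hp => ?_
      simpa using hp
    have : Measurable ((Metric.ball (0 : ℂ) R).indicator fun p => f (c + p)) := by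
      classical
      rw [← Set.piecewise_eq_indicator]
      exact hcont.measurable_piecewise continuousOn_const Metric.isOpen_ball.measurableSet
    have e : g = fun p => ‖(Metric.ball (0 : ℂ) R).indicator (fun p => f (c + p)) p‖ₑ := by
      ext p
      simp only [g, enorm_indicator_eq_indicator_enorm]
    rw [e]
    exact this.enorm
  have hpolar : Measurable fun p : ℝ × ℝ => Complex.polarCoord.symm p := by
    simp only [Complex.polarCoord_symm_apply]
    fun_prop
  rw [← lintegral_indicator Metric.isOpen_ball.measurableSet]
  change _ ≤ ∫⁻ p, g p
  rw [← Complex.lintegral_comp_polarCoord_symm, polarCoord_target, Measure.volume_eq_prod,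
    ← Measure.prod_restrict, lintegral_prod _ (by
      refine Measurable.aemeasurable ?_
      simp only [smul_eq_mul]
      exact measurable_fst.ennreal_ofReal.mul (hg.comp hpolar))]
  -- Only radii in `(R / 2, R)` are used, with `r ≥ R / 2`: whence the constant `(R / 2) · (R / 2) ·
  -- 2π = π R² / 2`.
  have hinner : ∀ r ∈ Set.Ioo (R / 2) R,
      ENNReal.ofReal (R / 2) * (ENNReal.ofReal (2 * Real.pi) * ‖f c‖ₑ)
      ≤ ∫⁻ θ in Set.Ioo (-Real.pi) Real.pi,
        ENNReal.ofReal (r, θ).1 • g (Complex.polarCoord.symm (r, θ)) := by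
    intro r hr
    have hr0 : 0 < r := (half_pos hR).trans hr.1
    simp only [smul_eq_mul]
    rw [lintegral_const_mul' _ _ ENNReal.ofReal_ne_top]
    refine mul_le_mul' (ENNReal.ofReal_le_ofReal hr.1.le) ?_
    refine (two_pi_mul_enorm_le_lintegral_circle hf hr0 hr.2).trans_eq
      (lintegral_congr fun θ => ?_)
    have hmem : Complex.polarCoord.symm (r, θ) ∈ Metric.ball (0 : ℂ) R := by
      rw [mem_ball_zero_iff, Complex.norm_polarCoord_symm, abs_of_pos hr0]
      exact hr.2
    simp only [g]
    rw [Set.indicator_of_mem hmem, Complex.polarCoord_symm_apply]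
  calc _ = ∫⁻ _ in Set.Ioo (R / 2) R,
          ENNReal.ofReal (R / 2) * (ENNReal.ofReal (2 * Real.pi) * ‖f c‖ₑ) := by
        rw [setLIntegral_const, Real.volume_Ioo, ← mul_assoc, ← ENNReal.ofReal_mul (by positivity),
          mul_right_comm, ← ENNReal.ofReal_mul (by positivity)]
        congr 2
        ring
    _ ≤ ∫⁻ r in Set.Ioo (R / 2) R, ∫⁻ θ in Set.Ioo (-Real.pi) Real.pi,
          ENNReal.ofReal (r, θ).1 • g (Complex.polarCoord.symm (r, θ)) :=
        setLIntegral_mono' measurableSet_Ioo hinner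
    _ ≤ _ := lintegral_mono_set fun r hr => (half_pos hR).trans hr.1

/-- The ball about `c` lies in a strip of width `2R` inside the half-plane, and each vertical line
contributes at most the supremum. -/
lemma setLIntegral_ball_le_iSup {V : ℂ → ℂ} {c : ℂ} {R : ℝ}
    (hc : R ≤ c.re) :
    ∫⁻ p in Metric.ball (0 : ℂ) R, ‖V (c + p)‖ₑ ^ 2 ≤ ENNReal.ofReal (2 * R) *
      ⨆ x ∈ Set.Ioi (0 : ℝ), ∫⁻ y : ℝ, ‖V ((x : ℂ) + (y : ℂ) * Complex.I)‖ₑ ^ 2 := by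
  set K := ⨆ x ∈ Set.Ioi (0 : ℝ), ∫⁻ y : ℝ, ‖V ((x : ℂ) + (y : ℂ) * Complex.I)‖ₑ ^ 2 with hK
  rw [← lintegral_indicator Metric.isOpen_ball.measurableSet,
    ← Complex.volume_preserving_equiv_real_prod.symm.lintegral_comp_emb
      Complex.measurableEquivRealProd.symm.measurableEmbedding, Measure.volume_eq_prod]
  -- This half of Tonelli needs no measurability, which is not assumed of `V` off the half-plane.
  refine (lintegral_prod_le _).trans ?_
  have hle : ∀ a : ℝ, ∫⁻ b : ℝ, (Metric.ball (0 : ℂ) R).indicator (fun p => ‖V (c + p)‖ₑ ^ 2)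
      (Complex.measurableEquivRealProd.symm (a, b))
      ≤ (Set.Ioo (-R) R).indicator (fun _ => K) a := by
    intro a
    by_cases ha : a ∈ Set.Ioo (-R) R
    · rw [Set.indicator_of_mem ha]
      calc _ ≤ ∫⁻ b : ℝ, ‖V (((c.re + a : ℝ) : ℂ) + ((c.im + b : ℝ) : ℂ) * Complex.I)‖ₑ ^ 2 := by
            refine lintegral_mono fun b => ?_
            refine (Set.indicator_le_self _ _ _).trans_eq ?_
            congr 3
            apply Complex.ext <;> simp [Complex.measurableEquivRealProd]
        _ = ∫⁻ b : ℝ, ‖V (((c.re + a : ℝ) : ℂ) + (b : ℂ) * Complex.I)‖ₑ ^ 2 :=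
            lintegral_add_left_eq_self
              (fun b : ℝ => ‖V (((c.re + a : ℝ) : ℂ) + (b : ℂ) * Complex.I)‖ₑ ^ 2) c.im
        _ ≤ K := le_iSup₂ (f := fun (x : ℝ) (_ : x ∈ Set.Ioi (0 : ℝ)) =>
              ∫⁻ y : ℝ, ‖V ((x : ℂ) + (y : ℂ) * Complex.I)‖ₑ ^ 2) (c.re + a)
              (show 0 < c.re + a by linarith [ha.1])
    · rw [Set.indicator_of_notMem ha, nonpos_iff_eq_zero]
      refine lintegral_eq_zero_of_ae_eq_zero (Eventually.of_forall fun b => ?_)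
      refine Set.indicator_of_notMem (fun hb => ha ?_) _
      rw [mem_ball_zero_iff] at hb
      have := (Complex.abs_re_le_norm _).trans_lt hb
      exact abs_lt.1 (by simpa [Complex.measurableEquivRealProd] using this)
  refine (lintegral_mono hle).trans_eq ?_
  rw [lintegral_indicator measurableSet_Ioo, setLIntegral_const, Real.volume_Ioo, mul_comm]
  congr 2
  ring

/-- The area estimate for `V²` on the ball of radius `x` about `z`, which fits in the half-plane. -/
lemma MemHardyTwo.exists_norm_le {V : ℂ → ℂ} (hV : MemHardyTwo V) {x : ℝ} (hx : 0 < x) :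
    ∃ C : ℝ, ∀ z : ℂ, x ≤ z.re → ‖V z‖ ≤ C := by
  set K := ⨆ x ∈ Set.Ioi (0 : ℝ), ∫⁻ y : ℝ, ‖V ((x : ℂ) + (y : ℂ) * Complex.I)‖ₑ ^ 2 with hK
  have hpi := Real.pi_pos
  set Q : ENNReal := ENNReal.ofReal (2 * x) * K / ENNReal.ofReal (Real.pi * x ^ 2 / 2) with hQ
  have hQtop : Q ≠ ⊤ := ENNReal.div_ne_top
    (ENNReal.mul_ne_top ENNReal.ofReal_ne_top hV.sup_lt_top.ne)
    (by rw [Ne, ENNReal.ofReal_eq_zero, not_le]; positivity)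
  refine ⟨√Q.toReal, fun z hz => Real.le_sqrt_of_sq_le ?_⟩
  have hd : DifferentiableOn ℂ (fun w => V w ^ 2) (Metric.ball z x) := by
    refine (hV.analytic.differentiableOn.mono fun w hw => ?_).pow 2
    rw [mem_ball_iff_norm] at hw
    have := (Complex.abs_re_le_norm (w - z)).trans_lt hw
    rw [Complex.sub_re, abs_lt] at this
    change 0 < w.re
    linarith
  have h1 := mul_enorm_le_setLIntegral_ball hx hd
  simp only [enorm_pow] at h1
  have h2 : ‖V z‖ₑ ^ 2 ≤ Q := by
    rw [hQ, ENNReal.le_div_iff_mul_le (Or.inl (by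
      rw [Ne, ENNReal.ofReal_eq_zero, not_le]; positivity)) (Or.inl ENNReal.ofReal_ne_top), mul_comm]
    exact h1.trans (setLIntegral_ball_le_iSup hz)
  have h3 := ENNReal.toReal_mono hQtop h2
  simpa using h3

lemma continuous_comp_vertical {E : Type*} [TopologicalSpace E] {f : ℂ → E}
    (hf : ContinuousOn f rightHalfPlane) {x : ℝ} (hx : 0 < x) :
    Continuous fun t : ℝ => f (x + t * Complex.I) :=
  hf.comp_continuous (by fun_prop) fun t => by simpa [rightHalfPlane] using hx

lemma continuousOn_comp_add {E : Type*} [TopologicalSpace E] {f : ℂ → E}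
    (hf : ContinuousOn f rightHalfPlane) {x : ℝ} (hx : 0 < x) :
    ContinuousOn (fun w : ℂ => f (x + w)) {w | 0 ≤ w.re} := by
  refine hf.comp (by fun_prop) fun w hw => ?_
  have hw : 0 ≤ w.re := hw
  simp only [rightHalfPlane, Set.mem_ofPred_eq, Complex.add_re, Complex.ofReal_re]
  linarith

lemma add_discToHalfPlane_mem {z w : ℂ} {x : ℝ} (hx : 0 < x) (hz : 0 < z.re) (hw : ‖w‖ < 1) :
    (x : ℂ) + discToHalfPlane z w ∈ rightHalfPlane := by
  have := discToHalfPlane_re_pos hz hw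
  simp only [rightHalfPlane, Set.mem_ofPred_eq, Complex.add_re, Complex.ofReal_re]
  linarith

lemma discToHalfPlane_zero (z : ℂ) : discToHalfPlane z 0 = z := by
  simp only [discToHalfPlane, add_zero, sub_zero, div_one, mul_one]
  rw [add_comm]
  exact Complex.re_add_im z

lemma analyticAt_comp_discToHalfPlane {f : ℂ → ℂ} (hf : AnalyticOnNhd ℂ f rightHalfPlane)
    {z w : ℂ} {x : ℝ} (hx : 0 < x) (hz : 0 < z.re) (hw : ‖w‖ < 1) :
    AnalyticAt ℂ (fun w => f (x + discToHalfPlane z w)) w := by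
  have hne : 1 - w ≠ 0 := by
    rw [sub_ne_zero]
    rintro rfl
    simp at hw
  have hd : AnalyticAt ℂ (fun w => (x : ℂ) + discToHalfPlane z w) w := by
    unfold discToHalfPlane
    fun_prop (disch := assumption)
  exact AnalyticAt.fun_comp (g := f) (f := fun w => (x : ℂ) + discToHalfPlane z w)
    (hf _ (add_discToHalfPlane_mem hx hz hw)) hd

/-- Translates of an `H²` function are Poisson integrals of their boundary values. -/
lemma MemHardyTwo.eq_integral_rightPoissonKernel {V : ℂ → ℂ} (hV : MemHardyTwo V) {x : ℝ}
    (hx : 0 < x) {z : ℂ} (hz : 0 < z.re) :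
    V (x + z) = ∫ t : ℝ, rightPoissonKernel z t • V (x + t * Complex.I) := by
  obtain ⟨C, hC⟩ := hV.exists_norm_le hx
  refine _root_.eq_integral_rightPoissonKernel (u := fun w => V (x + w)) (C := C) hz
    (continuousOn_comp_add hV.analytic.continuousOn hx) (fun w hw => ?_) (fun r hr => ?_)
  · have h1 : ‖V (x + w)‖ ≤ C := hC _ (by simpa using hw)
    refine h1.trans (le_mul_of_one_le_right ((norm_nonneg _).trans h1) ?_)
    exact Real.one_le_rpow (by linarith [norm_nonneg w]) (by norm_num)
  · have hd : DiffContOnCl ℂ (fun w => V (x + discToHalfPlane z w)) (Metric.ball 0 |r|) := by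
      rw [abs_of_pos hr.1]
      refine DifferentiableOn.diffContOnCl fun w hw => ?_
      rw [closure_ball _ hr.1.ne', mem_closedBall_zero_iff] at hw
      exact (analyticAt_comp_discToHalfPlane hV.analytic hx hz
        (hw.trans_lt hr.2)).differentiableAt.differentiableWithinAt
    rw [hd.circleAverage, discToHalfPlane_zero]

lemma cauchyWeight_le_volume : cauchyWeight ≤ volume := by
  calc cauchyWeight ≤ volume.withDensity 1 :=
        withDensity_mono (Eventually.of_forall fun t => by
          simp only [Pi.one_apply, ENNReal.ofReal_le_one]
          rw [div_le_one (by positivity)]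
          nlinarith [sq_nonneg t])
    _ = volume := withDensity_one

lemma MemHardyTwo.exists_eLpNorm_le {V : ℂ → ℂ} (hV : MemHardyTwo V) :
    ∃ C : ℝ, 0 ≤ C ∧ ∀ x : ℝ, 0 < x →
      eLpNorm (fun t : ℝ => V (x + t * Complex.I)) 2 cauchyWeight ≤ ENNReal.ofReal C := by
  set K := ⨆ x ∈ Set.Ioi (0 : ℝ), ∫⁻ y : ℝ, ‖V ((x : ℂ) + (y : ℂ) * Complex.I)‖ₑ ^ 2 with hK
  refine ⟨(K ^ (1 / 2 : ℝ)).toReal, ENNReal.toReal_nonneg, fun x hx => ?_⟩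
  rw [ENNReal.ofReal_toReal (ENNReal.rpow_ne_top_of_nonneg (by norm_num) hV.sup_lt_top.ne)]
  refine (eLpNorm_mono_measure _ cauchyWeight_le_volume).trans ?_
  rw [eLpNorm_eq_lintegral_rpow_enorm_toReal (by norm_num) (by norm_num)]
  simp only [ENNReal.toReal_ofNat, ENNReal.rpow_ofNat]
  gcongr
  exact le_iSup₂ (f := fun (x : ℝ) (_ : x ∈ Set.Ioi (0 : ℝ)) =>
    ∫⁻ y : ℝ, ‖V ((x : ℂ) + (y : ℂ) * Complex.I)‖ₑ ^ 2) x hx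

/-! ### Nonvanishing of `V` and size of `log |V|` -/

/-- A zero of `V` would be isolated; off it `V * (g / V) = g`, and continuity would force `g` to
vanish there too. The limit is punctured because division by zero yields zero. -/
lemma ne_zero_of_analyticOnNhd_div {V g : ℂ → ℂ} {U : Set ℂ} (hU : IsPreconnected U)
    (hV : AnalyticOnNhd ℂ V U) (hV0 : ∃ z ∈ U, V z ≠ 0)
    (hW : AnalyticOnNhd ℂ (fun z => g z / V z) U) (hg : AnalyticOnNhd ℂ g U)
    (hg0 : ∀ z ∈ U, g z ≠ 0) : ∀ z ∈ U, V z ≠ 0 := by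
  intro z hz h0
  rcases (hV z hz).eventually_eq_zero_or_eventually_ne_zero with h | h
  · obtain ⟨a, ha, hne⟩ := hV0
    exact hne (hV.eqOn_zero_of_preconnected_of_eventuallyEq_zero hU hz h ha)
  · have h1 : Tendsto (fun w => V w * (g w / V w)) (𝓝[≠] z) (𝓝 (V z * (g z / V z))) :=
      ((hV z hz).continuousAt.mul (hW z hz).continuousAt).tendsto.mono_left nhdsWithin_le_nhds
    have h2 : Tendsto g (𝓝[≠] z) (𝓝 (g z)) :=
      (hg z hz).continuousAt.tendsto.mono_left nhdsWithin_le_nhds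
    have h3 : Tendsto (fun w => V w * (g w / V w)) (𝓝[≠] z) (𝓝 (g z)) := by
      refine h2.congr' ?_
      filter_upwards [h] with w hw
      rw [mul_div_cancel₀ _ hw]
    have := tendsto_nhds_unique h1 h3
    rw [h0, zero_mul] at this
    exact hg0 z hz this.symm

lemma one_le_norm_one_add {z : ℂ} (hz : 0 ≤ z.re) : 1 ≤ ‖1 + z‖ := by
  have := Complex.re_le_norm (1 + z)
  simp only [Complex.add_re, Complex.one_re] at this
  linarith

lemma one_add_ne_zero_of_re_nonneg {z : ℂ} (hz : 0 ≤ z.re) : 1 + z ≠ 0 :=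
  norm_pos_iff.1 (one_pos.trans_le (one_le_norm_one_add hz))

lemma ne_zero_of_memHardyTwo {V : ℂ → ℂ} {n : ℕ} (hV : MemHardyTwo V)
    (hV0 : ∃ z ∈ rightHalfPlane, V z ≠ 0)
    (hW : MemHardyTwo (fun z : ℂ => (1 + z) ^ (-(n : ℤ)) / V z)) :
    ∀ z ∈ rightHalfPlane, V z ≠ 0 := by
  have hne : ∀ z ∈ rightHalfPlane, 1 + z ≠ 0 := fun z hz =>
    one_add_ne_zero_of_re_nonneg (le_of_lt hz)
  refine ne_zero_of_analyticOnNhd_div (convex_halfSpace_re_gt 0).isPreconnected hV.analytic hV0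
    hW.analytic (fun z hz => ?_) fun z hz => zpow_ne_zero _ (hne z hz)
  have : AnalyticAt ℂ (fun z : ℂ => 1 + z) z := by fun_prop
  exact this.zpow (hne z hz)

/-- `log a ≤ a` for `V` bounds `log |V|` above; for the quotient it bounds `log |V|` below, at the
cost of `n log |1 + z|`. -/
lemma abs_log_norm_le {V : ℂ → ℂ} {n : ℕ} {z : ℂ} (hz : 0 ≤ z.re) (hne : V z ≠ 0) :
    |Real.log ‖V z‖| ≤ ‖V z‖ + ‖(1 + z) ^ (-(n : ℤ)) / V z‖ + n * Real.log ‖1 + z‖ := by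
  have h1 := Real.log_le_self (norm_nonneg (V z))
  have h2 := Real.log_le_self (norm_nonneg ((1 + z) ^ (-(n : ℤ)) / V z))
  have h3 : 0 ≤ (n : ℝ) * Real.log ‖1 + z‖ :=
    mul_nonneg n.cast_nonneg (Real.log_nonneg (one_le_norm_one_add hz))
  have h4 : Real.log ‖(1 + z) ^ (-(n : ℤ)) / V z‖
      = -(n * Real.log ‖1 + z‖) - Real.log ‖V z‖ := by
    rw [norm_div, norm_zpow, Real.log_div
      (zpow_ne_zero _ (norm_ne_zero_iff.2 (one_add_ne_zero_of_re_nonneg hz)))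
      (norm_ne_zero_iff.2 hne), Real.log_zpow]
    push_cast
    ring
  have h5 := norm_nonneg (V z)
  have h6 := norm_nonneg ((1 + z) ^ (-(n : ℤ)) / V z)
  rw [abs_le]
  constructor <;> linarith

lemma continuousOn_log_norm {V : ℂ → ℂ} (hV : AnalyticOnNhd ℂ V rightHalfPlane)
    (hne : ∀ z ∈ rightHalfPlane, V z ≠ 0) :
    ContinuousOn (fun z => ((Real.log ‖V z‖ : ℝ) : ℂ)) rightHalfPlane :=
  Complex.continuous_ofReal.comp_continuousOn
    (hV.continuousOn.norm.log fun z hz => norm_ne_zero_iff.2 (hne z hz))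

/-- On `Re ≥ x` both `V` and the quotient are bounded, so `log |V|` grows at most logarithmically;
harmonicity gives the mean value property. -/
lemma log_norm_eq_integral_rightPoissonKernel {V : ℂ → ℂ} {n : ℕ} (hV : MemHardyTwo V)
    (hne : ∀ z ∈ rightHalfPlane, V z ≠ 0)
    (hW : MemHardyTwo (fun z : ℂ => (1 + z) ^ (-(n : ℤ)) / V z)) {x : ℝ}
    (hx : x ∈ Set.Ioo (0 : ℝ) 1) {z : ℂ} (hz : 0 < z.re) :
    ((Real.log ‖V (x + z)‖ : ℝ) : ℂ)
      = ∫ t : ℝ, rightPoissonKernel z t • ((Real.log ‖V (x + t * Complex.I)‖ : ℝ) : ℂ) := by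
  obtain ⟨C₁, hC₁⟩ := hV.exists_norm_le hx.1
  obtain ⟨C₂, hC₂⟩ := hW.exists_norm_le hx.1
  refine eq_integral_rightPoissonKernel (u := fun w => ((Real.log ‖V (x + w)‖ : ℝ) : ℂ))
    (C := C₁ + C₂ + n * 4) hz
    (continuousOn_comp_add (continuousOn_log_norm hV.analytic hne) hx.1)
    (fun w hw => ?_) (fun r hr => ?_)
  · have hre : x ≤ ((x : ℂ) + w).re := by simpa using hw
    have h1 := hC₁ _ hre
    have h2 := hC₂ _ hre
    have h12 : 0 ≤ C₁ + C₂ := add_nonneg ((norm_nonneg _).trans h1) ((norm_nonneg _).trans h2)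
    have h3 : (1 : ℝ) ≤ (1 + ‖w‖) ^ (1 / 2 : ℝ) :=
      Real.one_le_rpow (by linarith [norm_nonneg w]) (by norm_num)
    -- `log y ≤ 2 y^(1/2)` with `y ≤ 4 (1 + ‖w‖)` gives the constant `2 · 2`.
    have h4 : Real.log ‖1 + ((x : ℂ) + w)‖ ≤ 4 * (1 + ‖w‖) ^ (1 / 2 : ℝ) := by
      have hn : ‖1 + ((x : ℂ) + w)‖ ≤ 4 * (1 + ‖w‖) := by
        rw [← add_assoc]
        refine norm_add₃_le.trans ?_
        rw [norm_one, Complex.norm_real, Real.norm_of_nonneg hx.1.le]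
        linarith [norm_nonneg w, hx.2]
      have h5 := Real.log_le_rpow_div (norm_nonneg (1 + ((x : ℂ) + w)))
        (show (0 : ℝ) < 1 / 2 by norm_num)
      have h6 : ‖1 + ((x : ℂ) + w)‖ ^ (1 / 2 : ℝ) ≤ 2 * (1 + ‖w‖) ^ (1 / 2 : ℝ) := by
        refine (Real.rpow_le_rpow (norm_nonneg _) hn (by norm_num)).trans_eq ?_
        rw [Real.mul_rpow (by norm_num) (by positivity), ← Real.sqrt_eq_rpow,
          show (4 : ℝ) = 2 ^ 2 by norm_num, Real.sqrt_sq (by norm_num)]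
      linarith
    rw [Complex.norm_real, Real.norm_eq_abs]
    have h0 : 0 < ((x : ℂ) + w).re := hx.1.trans_le hre
    refine (abs_log_norm_le (n := n) h0.le (hne _ h0)).trans ?_
    have h7 := mul_le_mul_of_nonneg_left h4 (n.cast_nonneg : (0 : ℝ) ≤ n)
    nlinarith
  · have hh : InnerProductSpace.HarmonicOnNhd
        (fun w => ((Real.log ‖V (x + discToHalfPlane z w)‖ : ℝ) : ℂ))
        (Metric.closedBall 0 |r|) := by
      refine InnerProductSpace.HarmonicOnNhd.comp_CLM (l := Complex.ofRealCLM)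
        (f := fun w => Real.log ‖V (x + discToHalfPlane z w)‖) fun w hw => ?_
      rw [abs_of_pos hr.1, mem_closedBall_zero_iff] at hw
      have hw := hw.trans_lt hr.2
      exact (analyticAt_comp_discToHalfPlane hV.analytic hx.1 hz hw).harmonicAt_log_norm
        (hne _ (add_discToHalfPlane_mem hx.1 hz hw))
    rw [hh.circleAverage_eq, discToHalfPlane_zero]

/-- The exponent `1/8` squares to `1/4`, integrable against the weight, and still dominates a
logarithm. -/
lemma memLp_one_add_sq_rpow :
    MemLp (fun t : ℝ => (1 + t ^ 2) ^ (1 / 8 : ℝ)) 2 cauchyWeight := by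
  rw [memLp_two_iff_integrable_sq (Continuous.aestronglyMeasurable (by
    refine Continuous.rpow_const (by fun_prop) fun t => Or.inr (by norm_num)))]
  rw [integrable_cauchyWeight_iff]
  refine integrable_one_add_sq_rpow.congr (Eventually.of_forall fun t => ?_)
  simp only [smul_eq_mul]
  rw [← one_div_one_add_sq_mul_rpow, ← Real.rpow_mul_natCast (by positivity)]
  norm_num

lemma log_norm_one_add_vertical_le {x : ℝ} (hx : x ∈ Set.Ioo (0 : ℝ) 1) (t : ℝ) :
    Real.log ‖1 + ((x : ℂ) + t * Complex.I)‖ ≤ 8 * (1 + t ^ 2) ^ (1 / 8 : ℝ) := by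
  have hn : ‖1 + ((x : ℂ) + t * Complex.I)‖ ≤ 2 * (1 + t ^ 2) ^ (1 / 2 : ℝ) := by
    rw [← Real.sqrt_eq_rpow, show (2 : ℝ) = √4 by
      rw [show (4 : ℝ) = 2 ^ 2 by norm_num, Real.sqrt_sq (by norm_num)],
      ← Real.sqrt_mul (by norm_num), Complex.norm_def, Complex.normSq_apply]
    apply Real.sqrt_le_sqrt
    simp
    nlinarith [hx.1, hx.2, sq_nonneg t]
  -- `log y ≤ 4 y^(1/4)` and `2^(1/4) ≤ 2` give the constant `8`.
  have h5 := Real.log_le_rpow_div (norm_nonneg (1 + ((x : ℂ) + t * Complex.I)))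
    (show (0 : ℝ) < 1 / 4 by norm_num)
  have h6 : ‖1 + ((x : ℂ) + t * Complex.I)‖ ^ (1 / 4 : ℝ) ≤ 2 * (1 + t ^ 2) ^ (1 / 8 : ℝ) := by
    refine (Real.rpow_le_rpow (norm_nonneg _) hn (by norm_num)).trans ?_
    rw [Real.mul_rpow (by norm_num) (by positivity), ← Real.rpow_mul (by positivity)]
    norm_num
    gcongr
    calc (2 : ℝ) ^ (1 / 4 : ℝ) ≤ 2 ^ (1 : ℝ) :=
          Real.rpow_le_rpow_of_exponent_le (by norm_num) (by norm_num)
      _ = 2 := by norm_num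
  linarith

lemma exists_eLpNorm_log_norm_le {V : ℂ → ℂ} {n : ℕ} (hV : MemHardyTwo V)
    (hne : ∀ z ∈ rightHalfPlane, V z ≠ 0)
    (hW : MemHardyTwo (fun z : ℂ => (1 + z) ^ (-(n : ℤ)) / V z)) :
    ∃ C : ℝ, ∀ x ∈ Set.Ioo (0 : ℝ) 1,
      eLpNorm (fun t : ℝ => ((Real.log ‖V (x + t * Complex.I)‖ : ℝ) : ℂ)) 2 cauchyWeight
        ≤ ENNReal.ofReal C := by
  obtain ⟨C₁, h₁, hC₁⟩ := hV.exists_eLpNorm_le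
  obtain ⟨C₂, h₂, hC₂⟩ := hW.exists_eLpNorm_le
  have hm := memLp_one_add_sq_rpow.const_mul ((n : ℝ) * 8)
  set C₃ := eLpNorm (fun t : ℝ => (n : ℝ) * 8 * (1 + t ^ 2) ^ (1 / 8 : ℝ)) 2 cauchyWeight with hC₃
  refine ⟨C₁ + C₂ + C₃.toReal, fun x hx => ?_⟩
  have hVm := (continuous_comp_vertical hV.analytic.continuousOn hx.1).norm.aestronglyMeasurable
    (μ := cauchyWeight)
  have hWm := (continuous_comp_vertical hW.analytic.continuousOn hx.1).norm.aestronglyMeasurable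
    (μ := cauchyWeight)
  rw [ENNReal.ofReal_add (by positivity) ENNReal.toReal_nonneg, ENNReal.ofReal_add h₁ h₂,
    ENNReal.ofReal_toReal hm.2.ne]
  have hV' := hC₁ x hx.1
  have hW' := hC₂ x hx.1
  rw [← eLpNorm_norm] at hV' hW'
  refine le_trans (eLpNorm_mono_real (fun t => ?_))
    ((eLpNorm_add_le (hVm.add hWm) hm.1 (by norm_num)).trans
      (add_le_add_left ((eLpNorm_add_le hVm hWm (by norm_num)).trans (add_le_add hV' hW')) _))
  rw [Complex.norm_real, Real.norm_eq_abs]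
  have h0 : 0 < ((x : ℂ) + t * Complex.I).re := by simpa using hx.1
  refine (abs_log_norm_le (n := n) h0.le (hne _ h0)).trans ?_
  have := mul_le_mul_of_nonneg_left (log_norm_one_add_vertical_le hx t)
    (n.cast_nonneg : (0 : ℝ) ≤ n)
  simp only [Pi.add_apply]
  linarith

/-! ### The modulus of the outer part -/

lemma sub_mul_I_ne_zero {z : ℂ} (hz : 0 < z.re) (t : ℝ) : z - t * Complex.I ≠ 0 := by
  intro h
  have := congrArg Complex.re h
  simp at this
  exact hz.ne' this

/-- Splits off the weight; the other factor is bounded in `t` by `norm_one_sub_div_le`, so the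
integral defining `O_V` converges. -/
lemma schwarzKernel_eq {z : ℂ} (hz : 0 < z.re) (t : ℝ) :
    1 / (z - (t : ℂ) * Complex.I) - (t : ℂ) * Complex.I / (1 + (t : ℂ) ^ 2)
      = ((1 / (1 + t ^ 2) : ℝ) : ℂ) * ((1 - t * Complex.I * z) / (z - t * Complex.I)) := by
  have h1 := sub_mul_I_ne_zero hz t
  have h2 : (1 : ℂ) + (t : ℂ) ^ 2 ≠ 0 := by
    have : (0 : ℝ) < 1 + t ^ 2 := by positivity
    exact_mod_cast this.ne'
  push_cast
  rw [div_sub_div _ _ h1 h2, one_div_mul_eq_div, div_div]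
  congr 1
  linear_combination (t : ℂ) ^ 2 * Complex.I_sq

/-- The subtracted term is purely imaginary: it secures convergence without affecting the modulus.
-/
lemma schwarzKernel_re {z : ℂ} (t : ℝ) :
    ((1 / (z - (t : ℂ) * Complex.I) - (t : ℂ) * Complex.I / (1 + (t : ℂ) ^ 2))
      / (Real.pi : ℂ)).re = rightPoissonKernel z t := by
  have e : (t : ℂ) * Complex.I / (1 + (t : ℂ) ^ 2) = ((t / (1 + t ^ 2) : ℝ) : ℂ) * Complex.I := by
    push_cast
    ring
  rw [Complex.div_ofReal_re, Complex.sub_re, e, Complex.re_ofReal_mul, Complex.I_re, mul_zero,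
    sub_zero, one_div, Complex.inv_re, rightPoissonKernel, Complex.normSq_apply]
  simp
  ring

lemma norm_one_sub_div_le {z : ℂ} (hz : 0 < z.re) (t : ℝ) :
    ‖(1 - t * Complex.I * z) / (z - t * Complex.I)‖ ≤ (1 + ‖z‖ ^ 2) / z.re + ‖z‖ := by
  have h1 := norm_pos_iff.2 (sub_mul_I_ne_zero hz t)
  have hre : z.re ≤ ‖z - t * Complex.I‖ := by
    simpa using Complex.re_le_norm (z - t * Complex.I)
  have ht : |t| ≤ ‖z - t * Complex.I‖ + ‖z‖ := by
    have := norm_sub_le z (z - t * Complex.I)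
    rw [sub_sub_cancel, norm_mul, Complex.norm_I, mul_one, Complex.norm_real,
      Real.norm_eq_abs] at this
    linarith
  have hnum : ‖1 - t * Complex.I * z‖ ≤ 1 + |t| * ‖z‖ := by
    refine (norm_sub_le _ _).trans_eq ?_
    rw [norm_one, norm_mul, norm_mul, Complex.norm_I, mul_one, Complex.norm_real,
      Real.norm_eq_abs]
  rw [norm_div, div_le_iff₀ h1, add_mul, div_mul_eq_mul_div]
  have h2 : 1 + ‖z‖ ^ 2 ≤ (1 + ‖z‖ ^ 2) * ‖z - t * Complex.I‖ / z.re := by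
    rw [le_div_iff₀ hz]
    exact mul_le_mul_of_nonneg_left hre (by positivity)
  nlinarith [mul_le_mul_of_nonneg_right ht (norm_nonneg z)]

/-- The modulus of the outer part is the exponential of a Poisson integral. -/
lemma norm_outerPart {V : ℂ → ℂ}
    (hInt : Integrable (fun y : ℝ => Real.log ‖boundaryValue V y‖ / (1 + y ^ 2)))
    {z : ℂ} (hz : 0 < z.re) :
    ‖outerPart V z‖
      = Real.exp (∫ t : ℝ, rightPoissonKernel z t * Real.log ‖boundaryValue V t‖) := by
  have hI : Integrable fun t : ℝ => (Real.log ‖boundaryValue V t‖ : ℂ) *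
      (1 / (z - (t : ℂ) * Complex.I) - (t : ℂ) * Complex.I / (1 + (t : ℂ) ^ 2))
      / (Real.pi : ℂ) := by
    have hcont : Continuous fun t : ℝ => (1 - t * Complex.I * z) / (z - t * Complex.I) :=
      Continuous.div (by fun_prop) (by fun_prop) (sub_mul_I_ne_zero hz)
    have hInt' : Integrable fun y : ℝ =>
        ((Real.log ‖boundaryValue V y‖ / (1 + y ^ 2) : ℝ) : ℂ) := hInt.ofReal
    refine (hInt'.mul_bdd (c := (1 + ‖z‖ ^ 2) / z.re + ‖z‖)
      hcont.aestronglyMeasurable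
      (Eventually.of_forall (norm_one_sub_div_le hz))).div_const (Real.pi : ℂ) |>.congr
      (Eventually.of_forall fun t => ?_)
    simp only
    rw [schwarzKernel_eq hz]
    push_cast
    ring
  rw [outerPart, Complex.norm_exp]
  congr 1
  rw [← Complex.reCLM_apply, ← Complex.reCLM.integral_comp_comm hI]
  congr 1
  ext t
  rw [Complex.reCLM_apply, mul_div_assoc, Complex.re_ofReal_mul, schwarzKernel_re, mul_comm]

theorem proposition2p4 (V : ℂ → ℂ) (n : ℕ)
    (hV : MemHardyTwo V)
    (hV0 : ∃ z ∈ rightHalfPlane, V z ≠ 0)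
    (hW : MemHardyTwo (fun z : ℂ => (1 + z) ^ (-(n : ℤ)) / V z)) :
    IsOuterFunction V := by
  have hne := ne_zero_of_memHardyTwo hV hV0 hW
  obtain ⟨C₁, -, hC₁⟩ := hV.exists_eLpNorm_le
  obtain ⟨C₂, hC₂⟩ := exists_eLpNorm_log_norm_le hV hne hW
  obtain ⟨ψ, -, -, hψ⟩ := exists_radial_limit_of_poisson hV.analytic.continuousOn
    (fun x hx => hC₁ x hx.1) (fun x hx z hz => hV.eq_integral_rightPoissonKernel hx.1 hz)
  obtain ⟨φ, hφi, hφP, hφ⟩ := exists_radial_limit_of_poisson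
    (continuousOn_log_norm hV.analytic hne) hC₂
    (fun x hx z hz => log_norm_eq_integral_rightPoissonKernel hV hne hW hx hz)
  have hbv : ∀ᵐ y : ℝ, boundaryValue V y = ψ y := by
    filter_upwards [hψ] with y hy using hy.limUnder_eq
  -- Both radial limits exist almost everywhere and `|V| = exp (log |V|)`, so the boundary modulus
  -- is an exponential, hence nonzero.
  have hnorm : ∀ᵐ y : ℝ, ‖boundaryValue V y‖ = Real.exp (φ y).re := by
    filter_upwards [hψ, hφ, hbv] with y h1 h2 h3
    rw [h3]
    refine tendsto_nhds_unique h1.norm ?_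
    have h4 := (Real.continuous_exp.tendsto _).comp ((Complex.continuous_re.tendsto _).comp h2)
    refine h4.congr' ?_
    filter_upwards [self_mem_nhdsWithin] with x hx
    have hx : 0 < x := hx
    simp only [Function.comp_apply, Complex.ofReal_re]
    exact Real.exp_log (norm_pos_iff.2 (hne _ (by simpa [rightHalfPlane] using hx)))
  have hlog : ∀ᵐ y : ℝ, Real.log ‖boundaryValue V y‖ = (φ y).re := by
    filter_upwards [hnorm] with y hy
    rw [hy, Real.log_exp]
  have hInt : Integrable (fun y : ℝ => Real.log ‖boundaryValue V y‖ / (1 + y ^ 2)) := by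
    refine hφi.re.congr ?_
    filter_upwards [hlog] with y hy
    rw [hy, RCLike.re_to_complex, Complex.smul_re, smul_eq_mul]
    ring
  refine ⟨hV.analytic, ?_, ?_, hInt, fun z hz => ?_⟩
  · filter_upwards [hψ, hbv] with y h1 h2
    rwa [h2]
  · filter_upwards [hnorm] with y hy
    rw [← norm_pos_iff, hy]
    exact Real.exp_pos _
  · have hz : 0 < z.re := hz
    have h1 := congrArg Complex.re (hφP z hz)
    rw [Complex.ofReal_re, ← Complex.reCLM_apply,
      ← Complex.reCLM.integral_comp_comm (integrable_rightPoissonKernel_smul hz hφi)] at h1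
    rw [norm_outerPart hInt hz, ← Real.exp_log (norm_pos_iff.2 (hne z hz)), h1]
    congr 1
    refine integral_congr_ae ?_
    filter_upwards [hlog] with t ht
    rw [ht, Complex.reCLM_apply, Complex.smul_re, smul_eq_mul]
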